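/- Let $\mathbb F$ be a field of characteristic zero and let $G=N\rtimes H$ be a finite group which is a semidirect product of abelian groups, i.e. $N\trianglelefteq G$ and $H\le G$ are abelian subgroups with $NH=G$ and $N\cap H=1$. Assume that $\mathbb F$ contains a primitive root of unity of order $|G|$, and let $G$ act trivially on $\mathbb F$. For a finite directed graph $X=(V,E)$, let $Fl(X)$ be the group of flows on $X$: the functions $f:E\to\mathbb Z$ such that for every $v\in V$ the sum of $f$ over the edges with source $v$ equals the sum of $f$ over the edges with target $v$. A group acting on $X$ by graph automorphisms acts on $Fl(X)$. For a $G$-lattice $M$ (a $G$-module which is a finitely generated free abelian group), $\mathbb F(M)$ denotes the fraction field of the group algebra $\mathbb F[M]$ with the induced $G$-action $g(\alpha x^m)=\alpha x^{g(m)}$, and $\mathbb F(M)^G$ its field of invariants. Two field extensions $\mathbb L_1,\mathbb L_2$ of $\mathbb F$ are stably isomorphic over $\mathbb F$ if $\mathbb L_1(x_1,\dots,x_m)\cong\mathbb L_2(y_1,\dots,y_k)$ as $\mathbb F$-algebras for some $m,k\ge 0$ and algebraically independent indeterminates $x_i$, $y_j$. Put $H_0=H\cap Z(G)$, $\tilde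 G=G/H_0$ and $\tilde H=H/H_0$. Let $X$ be the complete directed graph without loops on the vertex set $G/H$ (one edge for each ordered pair of distinct vertices), with $G$ acting by left multiplication, and let $\tilde X$ be the complete directed graph without loops on $\tilde G/\tilde H$, with $\tilde G$ acting by left multiplication. Then the kernel of the action of $G$ on $G/H$ is exactly $H_0$, and the fields $$\mathbb F(Fl(X)\oplus\mathbb ZG)^G\qquad\text{and}\qquad \mathbb F(Fl(\tilde X)\oplus\mathbb Z\tilde G)^{\tilde G}$$ are stably isomorphic over $\mathbb F$. -/

import Mathlib

/-! ### Lattices and the invariant fields `F(M)^G` -/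

section InvariantFields

/-- The group algebra over a field of a free abelian group is an integral domain. -/
instance groupAlgebra_isDomain (F M : Type*) [Field F] [AddCommGroup M] [Module.Free ℤ M] :
    IsDomain (AddMonoidAlgebra F M) := by
  have : TwoUniqueSums M :=
    TwoUniqueSums.of_injective_addHom
      (Module.Free.chooseBasis ℤ M).repr.toLinearMap.toAddMonoidHom.toAddHom
      (Module.Free.chooseBasis ℤ M).repr.injective inferInstance
  infer_instance

/-- The field `F(M)`: the fraction field of the group algebra `F[M]`. -/
abbrev LatticeField (F M : Type*) [Field F] [AddCommGroup M] : Type _ :=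
  FractionRing (AddMonoidAlgebra F M)

variable {G M : Type*} [Group G] [AddCommGroup M]

/-- The additive automorphism of a `G`-module `M` by which `g` acts. -/
def moduleAut (ρ : Representation ℤ G M) (g : G) : M ≃+ M where
  toFun := ρ g
  invFun := ρ g⁻¹
  left_inv m := by simp
  right_inv m := by simp
  map_add' := map_add (ρ g)

/-- The automorphism `x^m ↦ x^(g m)` of the group algebra `F[M]`; the group acts trivially
on `F`. -/
noncomputable def groupAlgebraAut (F : Type*) [Field F] (ρ : Representation ℤ G M) (g : G) :
    AddMonoidAlgebra F M ≃ₐ[F] AddMonoidAlgebra F M :=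
  AddMonoidAlgebra.domCongr F F (moduleAut ρ g)

/-- The extension to the field of fractions `F(M)` of the action of `g` on `F[M]`. -/
noncomputable def latticeFieldAut (F : Type*) [Field F] (ρ : Representation ℤ G M) (g : G) :
    LatticeField F M ≃ₐ[F] LatticeField F M :=
  IsFractionRing.algEquivOfAlgEquiv (groupAlgebraAut F ρ g)

/-- The invariant field `F(M)^G`, as an extension of `F`. -/
noncomputable def invariantField (F : Type*) [Field F] [Module.Free ℤ M]
    (ρ : Representation ℤ G M) : IntermediateField F (LatticeField F M) where
  carrier := {x | ∀ g : G, latticeFieldAut F ρ g x = x}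
  mul_mem' hx hy g := by rw [map_mul, hx g, hy g]
  add_mem' hx hy g := by rw [map_add, hx g, hy g]
  algebraMap_mem' r g := (latticeFieldAut F ρ g).commutes r
  inv_mem' x hx g := by rw [map_inv₀, hx g]

/-- Two field extensions `L₁, L₂` of `F` are stably isomorphic over `F` if
`L₁(x₁, …, x_m) ≅ L₂(y₁, …, y_k)` as `F`-algebras, for some numbers `m, k` of independent
variables. -/
def StablyIsomorphic (F L₁ L₂ : Type*) [Field F] [Field L₁] [Field L₂]
    [Algebra F L₁] [Algebra F L₂] : Prop :=
  ∃ m k : ℕ, Nonempty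
    (FractionRing (MvPolynomial (Fin m) L₁) ≃ₐ[F] FractionRing (MvPolynomial (Fin k) L₂))

/-- The permutation module `ℤ^E` of integer valued functions on a `G`-set `E`, with the action
`(g f)(e) = f(g⁻¹ e)`. The indicator functions of points form a `G`-stable basis if `E` is
finite, so that this is the permutation lattice `ℤE`. -/
def permutationRep (G E : Type*) [Group G] [MulAction G E] : Representation ℤ G (E → ℤ) where
  toFun g := LinearMap.funLeft ℤ ℤ fun e : E => g⁻¹ • e
  map_one' := by ext; simp [LinearMap.funLeft]
  map_mul' g h := by
    refine LinearMap.ext fun f => funext fun e => ?_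
    simp [LinearMap.funLeft, mul_smul]

end InvariantFields

/-! ### Flows in graphs -/

/-- A directed graph with vertex set `V` and edge set `E`; loops and multiple edges are allowed. -/
structure EdgeGraph (V E : Type*) where
  source : E → V
  target : E → V

namespace EdgeGraph

variable {V E : Type*}

/-- The group `Fl(X)` of flows on a finite graph: functions `f : E → ℤ` such that at each vertex
the sum over the outgoing edges equals the sum over the incoming edges. -/
def flows [Finite E] (X : EdgeGraph V E) : Submodule ℤ (E → ℤ) where
  carrier := {f | ∀ v : V,
    ∑ᶠ e ∈ {e : E | X.source e = v}, f e = ∑ᶠ e ∈ {e : E | X.target e = v}, f e}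
  zero_mem' v := by simp
  add_mem' {f g} hf hg v := by
    simp only [Pi.add_apply]
    rw [finsum_mem_add_distrib (Set.toFinite _), finsum_mem_add_distrib (Set.toFinite _),
      hf v, hg v]
  smul_mem' c f hf v := by
    simp only [Pi.smul_apply]
    rw [← smul_finsum_mem (Set.toFinite _), ← smul_finsum_mem (Set.toFinite _), hf v]

/-- A graph action: `G` acts on vertices and on edges, compatibly with source and target. -/
class IsGraphAction (G : Type*) [Group G] [MulAction G V] [MulAction G E]
    (X : EdgeGraph V E) : Prop where
  source_smul : ∀ (g : G) (e : E), X.source (g • e) = g • X.source e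
  target_smul : ∀ (g : G) (e : E), X.target (g • e) = g • X.target e

theorem finsum_inv_smul {G : Type*} [Group G] [MulAction G V] [MulAction G E]
    (s : E → V) (hs : ∀ (g : G) (e : E), s (g • e) = g • s e) (g : G) (f : E → ℤ) (v : V) :
    ∑ᶠ e ∈ {e : E | s e = v}, f (g⁻¹ • e) = ∑ᶠ e ∈ {e : E | s e = g⁻¹ • v}, f e := by
  refine finsum_mem_eq_of_bijOn (fun e => g⁻¹ • e) ⟨?_, ?_, ?_⟩ fun _ _ => rfl
  · intro e he
    simp only [Set.mem_ofPred_eq] at he ⊢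
    rw [hs, he]
  · exact (MulAction.injective _).injOn
  · intro e he
    simp only [Set.mem_ofPred_eq] at he
    exact ⟨g • e, by simp [hs, he], by simp⟩

/-- The natural action of `G` on the lattice of flows: the restriction to `Fl(X)` of the action
on functions on the edges. -/
def flowRep (G : Type*) [Group G] [Finite E] [MulAction G V] [MulAction G E]
    (X : EdgeGraph V E) [X.IsGraphAction G] : Representation ℤ G X.flows :=
  (permutationRep G E).subrepresentation X.flows fun g f hf v => by
    change ∑ᶠ e ∈ {e : E | X.source e = v}, f (g⁻¹ • e)
      = ∑ᶠ e ∈ {e : E | X.target e = v}, f (g⁻¹ • e)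
    rw [finsum_inv_smul X.source IsGraphAction.source_smul,
      finsum_inv_smul X.target IsGraphAction.target_smul, hf]

end EdgeGraph

/-- The set of all ordered pairs of distinct elements of `V`. -/
def LooplessEdge (V : Type*) : Type _ := {p : V × V // p.1 ≠ p.2}

instance LooplessEdge.instFinite (V : Type*) [Finite V] : Finite (LooplessEdge V) :=
  inferInstanceAs (Finite {p : V × V // p.1 ≠ p.2})

instance LooplessEdge.instMulAction (G V : Type*) [Group G] [MulAction G V] :
    MulAction G (LooplessEdge V) where
  smul g p := ⟨(g • p.1.1, g • p.1.2), fun h => p.2 (MulAction.injective g h)⟩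
  one_smul p := Subtype.ext (Prod.ext (one_smul G p.1.1) (one_smul G p.1.2))
  mul_smul g h p := Subtype.ext (Prod.ext (mul_smul g h p.1.1) (mul_smul g h p.1.2))

/-- The complete directed graph without loops on `V`. -/
def completeLooplessGraph (V : Type*) : EdgeGraph V (LooplessEdge V) where
  source p := p.1.1
  target p := p.1.2

instance completeLooplessGraph_isGraphAction (G V : Type*) [Group G] [MulAction G V] :
    (completeLooplessGraph V).IsGraphAction G where
  source_smul _ _ := rfl
  target_smul _ _ := rfl

/-- The field `F(Fl(X) ⊕ ℤG)^G` where `X` is the complete loopless graph on `G/H`, on which `G`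
acts by left multiplication. -/
noncomputable abbrev flowField (F : Type*) [Field F] (G : Type*) [Group G] [Finite G]
    (H : Subgroup G) :
    IntermediateField F
      (LatticeField F ((completeLooplessGraph (G ⧸ H)).flows × (G → ℤ))) :=
  invariantField F
    (((completeLooplessGraph (G ⧸ H)).flowRep G).prod (permutationRep G G))

instance inf_center_normal {G : Type*} [Group G] (H : Subgroup G) :
    (H ⊓ Subgroup.center G).Normal where
  conj_mem n hn g := by
    rwa [(Subgroup.mem_center_iff.mp hn.2 g), mul_inv_cancel_right]

/-! Write `H₀ = H ∩ Z(G)`, `G̃ = G/H₀`, and `M` for the lattice of flows, which is the same for `X`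
and `X̃` because `G/H` and `G̃/H̃` are equivalent vertex sets. Both invariant fields are compared
with the invariants of the larger field `K = F(M ⊕ ℤG ⊕ ℤG̃)` under `G`: it is shown that `K^G` is
purely transcendental over `F(M ⊕ ℤG)^G` as well as over `F(M ⊕ ℤG̃)^G = F(M ⊕ ℤG̃)^G̃`.

Both assertions are instances of one statement about a tower `F ⊆ L ⊆ K` with compatible actions
of a finite group `G`, where `K = L(x₁, …, xₙ)` with independent variables whose `L`-span `W` is
stable under `G` (`exists_fractionRing_equiv_actionFixedField`). The action on `L` need not be
faithful; it is enough that the elements acting trivially on `L` are separated by the characters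
`G → Fˣ`. The proof has two steps.

* Galois descent, twisted by characters: `W` is spanned over `L` by eigenvectors
  (`le_span_eigenvectors`). Indeed, by Dedekind's theorem applied to the maps
  `(b, χ) ↦ g(b) χ(g)`, no linear functional that is nonzero on `W` kills all the averages
  `∑ χ(g) g(b v)`. So the variables may be replaced by eigenvectors `zᵢ`.
* If the `zᵢ` are eigenvectors, then the exponents `a` for which some nonzero `L`-multiple of `z^a`
  is invariant form a lattice. A basis of it gives invariant elements `wⱼ = lⱼ z^(aⱼ)`, and
  averaging a representation of an element of `K` in terms of the products `l z^a` shows that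
  `K^G = L^G(w)` (`exists_generators_of_eigenvectors`).

Over `F(M ⊕ ℤG)` the action is faithful. Over `F(M ⊕ ℤG̃)` the kernel is `H₀`, and its elements are
separated by characters of `G`, because `G/N ≅ H` is abelian and `F` contains the necessary roots of
unity (`exists_character_apply_ne_one`). -/

/-! ### Twisted Galois descent -/

section InvariantsOfRationalExtensions

variable {F L K G : Type*} [Field F] [Field L] [Field K] [Algebra F L] [Algebra F K] [Algebra L K]
  [IsScalarTower F L K] [Group G]

/-- The field of invariants of a group acting on an extension `K` of `F`. -/
def actionFixedField (τ : G →* (K ≃ₐ[F] K)) : IntermediateField F K :=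
  IntermediateField.fixedField τ.range

theorem mem_actionFixedField {τ : G →* (K ≃ₐ[F] K)} {x : K} :
    x ∈ actionFixedField τ ↔ ∀ g, τ g x = x := by
  simp [actionFixedField]

theorem sum_mem_actionFixedField [Fintype G] (τ : G →* (K ≃ₐ[F] K)) (x : K) :
    ∑ g, τ g x ∈ actionFixedField τ := by
  rw [mem_actionFixedField]
  intro h
  rw [map_sum]
  exact Fintype.sum_equiv (Equiv.mulLeft h) _ _ fun g => by simp

/-- The average `∑ χ(g) g(x)` is an eigenvector, with character `χ⁻¹`. -/
theorem map_sum_smul_eq_inv_smul [Fintype G] (τ : G →* (K ≃ₐ[F] K)) (χ : G →* Fˣ) (x : K)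
    (h : G) :
    τ h (∑ g, (χ g : F) • τ g x) = (χ⁻¹ h : Fˣ).val • ∑ g, (χ g : F) • τ g x := by
  rw [map_sum, Finset.smul_sum]
  refine Fintype.sum_equiv (Equiv.mulLeft h) _ _ fun g => ?_
  simp [smul_smul]

/-- Galois descent twisted by characters: if the elements of `G` acting trivially on `L` are
separated by the characters of `G` with values in `F`, then a `G`-stable `L`-subspace of `K` is
spanned by eigenvectors. -/
theorem le_span_eigenvectors [Finite G] (σ : G →* (L ≃ₐ[F] L)) (τ : G →* (K ≃ₐ[F] K))
    (hστ : ∀ g l, τ g (algebraMap L K l) = algebraMap L K (σ g l))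
    (hsep : ∀ g, (∀ l, σ g l = l) → (∀ χ : G →* Fˣ, χ g = 1) → g = 1)
    (W : Submodule L K) (hW : ∀ g, ∀ v ∈ W, τ g v ∈ W) :
    W ≤ Submodule.span L {v | v ∈ W ∧ ∃ χ : G →* Fˣ, ∀ g, τ g v = (χ g : F) • v} := by
  intro v hv
  by_contra hvU
  obtain ⟨f, hfv, hf⟩ := Submodule.exists_le_ker_of_notMem hvU
  cases nonempty_fintype G
  let φ : G → (L × (G →* Fˣ) →* L) := fun g =>
    { toFun := fun p => σ g p.1 * algebraMap F L (p.2 g)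
      map_one' := by simp
      map_mul' := fun p q => by simp; ring }
  -- the kernel of `G → Aut L` is separated by characters, so the `φ g` are distinct
  have hφ : Function.Injective φ := by
    intro g h hgh
    have key : ∀ (l : L) (χ : G →* Fˣ),
        σ g l * algebraMap F L (χ g) = σ h l * algebraMap F L (χ h) := fun l χ =>
      DFunLike.congr_fun hgh (l, χ)
    refine (inv_mul_eq_one.mp (hsep (g⁻¹ * h) (fun l => ?_) fun χ => ?_))
    · have := key l 1
      simp only [MonoidHom.one_apply, Units.val_one, map_one, mul_one] at this
      rw [map_mul, AlgEquiv.mul_apply, ← this, ← AlgEquiv.mul_apply, ← map_mul, inv_mul_cancel,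
        map_one, AlgEquiv.one_apply]
    · have := key 1 χ
      simp only [map_one, one_mul] at this
      rw [map_mul, map_inv, inv_mul_eq_one]
      exact Units.ext ((algebraMap F L).injective this)
  have hli := (linearIndependent_monoidHom (L × (G →* Fˣ)) L).comp φ hφ
  rw [Fintype.linearIndependent_iff] at hli
  -- `f` kills the twisted averages `∑ χ(g) g(b v)`, as these are eigenvectors
  have h0 := hli (fun g => f (τ g v)) (funext fun p => ?_) 1
  · exact hfv (by simpa using h0)
  · obtain ⟨b, χ⟩ := p
    have hmem : ∑ g, (χ g : F) • τ g (b • v) ∈ LinearMap.ker f := by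
      refine hf (Submodule.subset_span ⟨?_, χ⁻¹, map_sum_smul_eq_inv_smul τ χ _⟩)
      refine Submodule.sum_mem _ fun g _ => ?_
      rw [← algebraMap_smul L (χ g : F)]
      exact W.smul_mem _ (hW g _ (W.smul_mem _ hv))
    rw [LinearMap.mem_ker, map_sum] at hmem
    simp only [Finset.sum_apply, Pi.smul_apply, Function.comp_apply, Pi.zero_apply]
    rw [← hmem]
    refine Finset.sum_congr rfl fun g _ => ?_
    rw [← algebraMap_smul L (χ g : F), map_smul, Algebra.smul_def b v, map_mul, hστ,
      ← Algebra.smul_def, map_smul]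
    simp only [φ, smul_eq_mul, MonoidHom.coe_mk, OneHom.coe_mk]
    ring

/-! ### Replacing generators of a purely transcendental extension -/

/-- A family over which `K` is algebraic is algebraically independent as soon as it has no more
members than some algebraically independent family. -/
theorem AlgebraicIndependent.of_card_le_of_isAlgebraic {ι κ L K : Type*} [Field L] [Field K]
    [Algebra L K] [Finite ι] [Finite κ] {x : ι → K} (hx : AlgebraicIndependent L x) (w : κ → K)
    (hcard : Nat.card κ ≤ Nat.card ι)
    [Algebra.IsAlgebraic (IntermediateField.adjoin L (Set.range w)) K] :
    AlgebraicIndependent L w := by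
  have : Algebra.IsAlgebraic (Algebra.adjoin L (Set.range w)) K :=
    IntermediateField.isAlgebraic_adjoin_iff_top.mp inferInstance
  refine (Algebra.IsAlgebraic.isTranscendenceBasis_of_lift_le_trdeg_of_finite L w ?_).1
  have h := hx.lift_cardinalMk_le_trdeg
  rw [← Nat.cast_card, Cardinal.lift_natCast, Cardinal.nat_le_lift_iff] at h ⊢
  exact (Nat.cast_le.mpr hcard).trans h

end InvariantsOfRationalExtensions

/-! ### Invariants of Laurent monomials -/

section LaurentMonomials

variable {L K ι : Type*} [Field L] [Field K] [Algebra L K] [Fintype ι]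

/-- The Laurent monomial `∏ zᵢ ^ aᵢ`. -/
def laurentMonomial (z : ι → Kˣ) (a : ι → ℤ) : Kˣ := ∏ i, z i ^ a i

theorem laurentMonomial_zero (z : ι → Kˣ) : laurentMonomial z 0 = 1 := by
  simp [laurentMonomial]

theorem laurentMonomial_add (z : ι → Kˣ) (a b : ι → ℤ) :
    laurentMonomial z (a + b) = laurentMonomial z a * laurentMonomial z b := by
  simp [laurentMonomial, zpow_add, Finset.prod_mul_distrib]

theorem laurentMonomial_neg (z : ι → Kˣ) (a : ι → ℤ) :
    laurentMonomial z (-a) = (laurentMonomial z a)⁻¹ := by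
  simp [laurentMonomial]

theorem laurentMonomial_single [DecidableEq ι] (z : ι → Kˣ) (i : ι) (n : ℤ) :
    laurentMonomial z (Pi.single i n) = z i ^ n := by
  rw [laurentMonomial, Finset.prod_eq_single i]
  · simp
  · intro j _ hj
    simp [hj]
  · simp

variable (L) in
/-- The group of exponents `a` such that some nonzero `L`-multiple of the Laurent monomial `z ^ a`
lies in the subfield `S` of `K`. -/
def exponentGroup (z : ι → Kˣ) (S : Subfield K) : AddSubgroup (ι → ℤ) where
  carrier := {a | ∃ l : Lˣ, algebraMap L K l * laurentMonomial z a ∈ S}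
  zero_mem' := ⟨1, by simp [laurentMonomial_zero, one_mem]⟩
  add_mem' := by
    rintro a b ⟨l, hl⟩ ⟨m, hm⟩
    refine ⟨l * m, ?_⟩
    convert mul_mem hl hm using 1
    simp [laurentMonomial_add]
    ring
  neg_mem' := by
    rintro a ⟨l, hl⟩
    refine ⟨l⁻¹, ?_⟩
    convert inv_mem hl using 1
    simp [laurentMonomial_neg]
    ring

/-- Any two nonzero multiples of a Laurent monomial differ by a factor from `L`, so that
membership in `S` of one multiple settles the question for all multiples in `S'`. -/
theorem mul_laurentMonomial_mem {z : ι → Kˣ} {S S' : Subfield K} (hS : S ≤ S')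
    (hL : ∀ l, algebraMap L K l ∈ S' → algebraMap L K l ∈ S) {a : ι → ℤ}
    (ha : a ∈ exponentGroup L z S) {l : L} (hl : algebraMap L K l * laurentMonomial z a ∈ S') :
    algebraMap L K l * laurentMonomial z a ∈ S := by
  obtain ⟨m, hm⟩ := ha
  have hm0 : algebraMap L K m ≠ 0 := by simp
  have h : algebraMap L K l * laurentMonomial z a =
      algebraMap L K (l * (m : L)⁻¹) * (algebraMap L K m * laurentMonomial z a) := by
    rw [map_mul, map_inv₀]
    field_simp
  have hz : (laurentMonomial z a : K) ≠ 0 := Units.ne_zero _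
  rw [h]
  refine mul_mem (hL _ ?_) hm
  convert mul_mem hl (inv_mem (hS hm)) using 1
  rw [map_mul, map_inv₀]
  field_simp

end LaurentMonomials

/-! ### Invariants of a purely transcendental extension -/

section RationalInvariants

variable {F L K G ι : Type*} [Field F] [CharZero F] [Field L] [Field K] [Algebra F L] [Algebra F K]
  [Algebra L K] [IsScalarTower F L K] [Group G] [Finite G] [Finite ι]

theorem isAlgebraic_actionFixedField {F L G : Type*} [Field F] [Field L] [Algebra F L] [Group G]
    [Finite G] (σ : G →* (L ≃ₐ[F] L)) (l : L) :
    IsAlgebraic (actionFixedField σ) l := by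
  have : Finite σ.range := Set.finite_range σ
  exact (FixedPoints.isIntegral (G := σ.range) (F := L) l).isAlgebraic

/-- If `K = L(z)` for algebraically independent eigenvectors `z`, then `K^G = L^G(w)`, where `w` is
algebraically independent and consists of multiples `l z^a`, for `a` in a basis of the lattice of
those exponents for which an invariant nonzero multiple exists. -/
theorem exists_generators_of_eigenvectors (σ : G →* (L ≃ₐ[F] L)) (τ : G →* (K ≃ₐ[F] K))
    (hστ : ∀ g l, τ g (algebraMap L K l) = algebraMap L K (σ g l))
    {z : ι → K} (hz : AlgebraicIndependent L z)
    (hgen : IntermediateField.adjoin L (Set.range z) = ⊤) (χ : ι → G →* Fˣ)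
    (hχ : ∀ i g, τ g (z i) = (χ i g : F) • z i) :
    ∃ (n : ℕ) (w : Fin n → K), AlgebraicIndependent L w ∧
      ∀ u, u ∈ IntermediateField.adjoin (actionFixedField σ) (Set.range w) ↔
        u ∈ actionFixedField τ := by
  classical
  cases nonempty_fintype ι
  cases nonempty_fintype G
  obtain ⟨zu, rfl⟩ : ∃ zu : ι → Kˣ, (fun i => (zu i : K)) = z :=
    ⟨fun i => Units.mk0 (z i) (hz.ne_zero i), rfl⟩
  set KG := actionFixedField τ
  obtain ⟨n, b⟩ := Submodule.basisOfPid (Pi.basisFun ℤ ι)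
    (exponentGroup L zu KG.toSubfield).toIntSubmodule
  have hb : ∀ j, ∃ l : Lˣ, algebraMap L K l * laurentMonomial zu (b j) ∈ KG.toSubfield :=
    fun j => (b j).2
  choose l hl using hb
  set w : Fin n → K := fun j => algebraMap L K (l j) * laurentMonomial zu (b j)
  set E := IntermediateField.adjoin (actionFixedField σ) (Set.range w)
  have hLE : ∀ m ∈ actionFixedField σ, algebraMap L K m ∈ E := fun m hm =>
    E.algebraMap_mem ⟨m, hm⟩
  have hEK : E.toSubfield ≤ KG.toSubfield := by
    intro u hu
    have hu' : u ∈ IntermediateField.adjoin (actionFixedField σ) (Set.range w) := hu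
    clear hu
    change u ∈ KG
    induction hu' using IntermediateField.adjoin_induction with
    | mem x hx => obtain ⟨j, rfl⟩ := hx; exact hl j
    | algebraMap x =>
      refine mem_actionFixedField.mpr fun g => ?_
      change τ g (algebraMap L K x) = algebraMap L K x
      rw [hστ, mem_actionFixedField.mp x.2]
    | add x y _ _ hx hy => exact add_mem hx hy
    | inv x _ hx => exact inv_mem hx
    | mul x y _ _ hx hy => exact mul_mem hx hy
  -- the exponents of `E` form a group that contains a basis of the exponents of `K^G`
  have hPE : ∀ a ∈ exponentGroup L zu KG.toSubfield, a ∈ exponentGroup L zu E.toSubfield := by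
    intro a ha
    have h : ⊤ ≤ Submodule.comap
        (Submodule.subtype (exponentGroup L zu KG.toSubfield).toIntSubmodule)
        (exponentGroup L zu E.toSubfield).toIntSubmodule := by
      rw [← b.span_eq, Submodule.span_le]
      rintro _ ⟨j, rfl⟩
      exact ⟨l j, IntermediateField.subset_adjoin _ _ ⟨j, rfl⟩⟩
    exact h (x := ⟨a, ha⟩) trivial
  have hLG : ∀ m, algebraMap L K m ∈ KG.toSubfield → algebraMap L K m ∈ E.toSubfield := by
    refine fun m hm => hLE m (mem_actionFixedField.mpr fun g => (algebraMap L K).injective ?_)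
    rw [← hστ]
    exact mem_actionFixedField.mp hm g
  have hmon : ∀ (m : L) (a : ι → ℤ), algebraMap L K m * laurentMonomial zu a ∈ KG →
      algebraMap L K m * laurentMonomial zu a ∈ E := by
    intro m a h
    rcases eq_or_ne m 0 with rfl | hm
    · simp
    · exact mul_laurentMonomial_mem hEK hLG (hPE a ⟨Units.mk0 m hm, h⟩) h
  -- characters of `G` have order dividing `|G|`, so `zᵢ ^ |G|` is invariant
  have hpow : ∀ i, (zu i : K) ^ Nat.card G ∈ E := by
    intro i
    have h := hmon 1 (Pi.single i (Nat.card G))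
    rw [laurentMonomial_single, map_one, one_mul, zpow_natCast, Units.val_pow_eq_pow_val] at h
    refine h (mem_actionFixedField.mpr fun g => ?_)
    rw [map_pow, hχ, smul_pow, ← Units.val_pow_eq_pow_val, ← map_pow, pow_card_eq_one', map_one,
      Units.val_one, one_smul]
  have hact : ∀ g (a : ι → ℤ), ∃ c : F,
      τ g (laurentMonomial zu a) = c • (laurentMonomial zu a : K) := by
    intro g a
    refine ⟨∏ i, (χ i g : F) ^ a i, ?_⟩
    simp only [laurentMonomial, Units.coe_prod, Units.val_zpow_eq_zpow_val, map_prod, map_zpow₀,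
      Algebra.smul_def, ← Finset.prod_mul_distrib]
    exact Finset.prod_congr rfl fun i _ => by rw [hχ, Algebra.smul_def, mul_zpow]
  -- averaging turns `m z^a` into an invariant of the form `m' z^a`
  have havg : ∀ (m : L) (a : ι → ℤ),
      ∑ g, τ g (algebraMap L K m * laurentMonomial zu a) ∈ E := by
    intro m a
    choose c hc using fun g => hact g a
    have h : ∑ g, τ g (algebraMap L K m * laurentMonomial zu a) =
        algebraMap L K (∑ g, σ g m * algebraMap F L (c g)) * laurentMonomial zu a := by
      rw [map_sum, Finset.sum_mul]
      refine Finset.sum_congr rfl fun g _ => ?_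
      rw [map_mul, hστ, hc, map_mul, ← IsScalarTower.algebraMap_apply, Algebra.smul_def, mul_assoc]
    have := sum_mem_actionFixedField τ (algebraMap L K m * laurentMonomial zu a)
    rw [h] at this ⊢
    exact hmon _ _ this
  -- `L` and the `zᵢ` are algebraic over `E`, so the ring that they generate is the field `K`
  have hKalg : ∀ u : K, u ∈ Submodule.span E
      (Submonoid.closure (Set.range (algebraMap L K) ∪ Set.range fun i => (zu i : K)) : Set K) := by
    intro u
    rw [← Algebra.adjoin_eq_span, ← IntermediateField.adjoin_toSubalgebra_of_isAlgebraic]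
    · change u ∈ IntermediateField.adjoin E _
      have hu : u ∈ IntermediateField.adjoin L (Set.range fun i => (zu i : K)) := by
        rw [hgen]; trivial
      induction hu using IntermediateField.adjoin_induction with
      | mem x hx => exact IntermediateField.subset_adjoin _ _ (Or.inr hx)
      | algebraMap x => exact IntermediateField.subset_adjoin _ _ (Or.inl ⟨x, rfl⟩)
      | add x y _ _ hx hy => exact add_mem hx hy
      | inv x _ hx => exact inv_mem hx
      | mul x y _ _ hx hy => exact mul_mem hx hy
    · rintro _ (⟨m, rfl⟩ | ⟨i, rfl⟩)
      · have h1 : IsAlgebraic (actionFixedField σ) (algebraMap L K m) :=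
          (isAlgebraic_actionFixedField σ m).algebraMap
        exact h1.tower_top E
      · refine IsAlgebraic.of_pow Nat.card_pos ?_ (n := Nat.card G)
        exact isAlgebraic_algebraMap (⟨_, hpow i⟩ : E)
  have havg' : ∀ u : K, ∑ g, τ g u ∈ E := by
    intro u
    induction hKalg u using Submodule.span_induction with
    | zero => simp
    | add x y _ _ hx hy =>
      simp only [map_add, Finset.sum_add_distrib]
      exact add_mem hx hy
    | smul e x _ hx =>
      have h : ∑ g, τ g (e • x) = e • ∑ g, τ g x := by
        rw [Finset.smul_sum]
        refine Finset.sum_congr rfl fun g _ => ?_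
        change τ g (e * x) = e * τ g x
        rw [map_mul, mem_actionFixedField.mp (hEK e.2)]
      rw [h]
      exact E.mul_mem e.2 hx
    | mem x hx =>
      obtain ⟨m, a, rfl⟩ : ∃ (m : L) (a : ι → ℤ),
          x = algebraMap L K m * laurentMonomial zu a := by
        induction hx using Submonoid.closure_induction with
        | mem x hx =>
          rcases hx with ⟨m, rfl⟩ | ⟨i, rfl⟩
          · exact ⟨m, 0, by simp [laurentMonomial_zero]⟩
          · exact ⟨1, Pi.single i 1, by simp [laurentMonomial_single]⟩
        | one => exact ⟨1, 0, by simp [laurentMonomial_zero]⟩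
        | mul x y _ _ hx hy =>
          obtain ⟨m, a, rfl⟩ := hx
          obtain ⟨m', a', rfl⟩ := hy
          exact ⟨m * m', a + a', by simp [laurentMonomial_add]; ring⟩
      exact havg m a
  refine ⟨n, w, ?_, fun u => ⟨fun hu => hEK hu, fun hu => ?_⟩⟩
  · have hcard : Nat.card (Fin n) ≤ Nat.card ι := by
      have h := (b.linearIndependent.map' (Submodule.subtype _)
        (Submodule.ker_subtype _)).fintype_card_le_finrank
      simpa [Nat.card_eq_fintype_card] using h
    have : Algebra.IsAlgebraic (IntermediateField.adjoin L (Set.range w)) K := by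
      constructor
      intro u
      have hu : u ∈ IntermediateField.adjoin L (Set.range fun i => (zu i : K)) := by
        rw [hgen]; trivial
      induction hu using IntermediateField.adjoin_induction with
      | mem x hx =>
        obtain ⟨i, rfl⟩ := hx
        refine IsAlgebraic.of_pow Nat.card_pos ?_ (n := Nat.card G)
        have hle : E ≤ (IntermediateField.adjoin L (Set.range w)).restrictScalars _ :=
          IntermediateField.adjoin_le_iff.mpr (IntermediateField.subset_adjoin _ _)
        exact isAlgebraic_algebraMap (⟨_, hle (hpow i)⟩ : IntermediateField.adjoin L (Set.range w))
      | algebraMap x =>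
        exact isAlgebraic_algebraMap (algebraMap L (IntermediateField.adjoin L (Set.range w)) x)
      | add x y _ _ hx hy => exact hx.add hy
      | inv x _ hx => exact hx.inv
      | mul x y _ _ hx hy => exact hx.mul hy
    exact hz.of_card_le_of_isAlgebraic w hcard
  · have h := havg' u
    simp only [mem_actionFixedField.mp hu, Finset.sum_const, Finset.card_univ, nsmul_eq_mul] at h
    have : CharZero K := charZero_of_injective_algebraMap (algebraMap F K).injective
    have hc : (Fintype.card G : K) ≠ 0 := Nat.cast_ne_zero.mpr Fintype.card_ne_zero
    have := E.mul_mem (inv_mem (natCast_mem E (Fintype.card G))) h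
    rwa [inv_mul_cancel_left₀ hc] at this

/-- The invariants of a purely transcendental extension `K = L(x)`, on whose variables `G` acts
linearly over `L`, form a purely transcendental extension of `L^G`. The action on `L` may have a
kernel, provided that the characters of `G` with values in `F` separate its elements. -/
theorem exists_fractionRing_equiv_actionFixedField (σ : G →* (L ≃ₐ[F] L)) (τ : G →* (K ≃ₐ[F] K))
    (hστ : ∀ g l, τ g (algebraMap L K l) = algebraMap L K (σ g l))
    (hsep : ∀ g, (∀ l, σ g l = l) → (∀ χ : G →* Fˣ, χ g = 1) → g = 1)
    {x : ι → K} (hx : AlgebraicIndependent L x)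
    (hgen : IntermediateField.adjoin L (Set.range x) = ⊤)
    (hstable : ∀ g i, τ g (x i) ∈ Submodule.span L (Set.range x)) :
    ∃ n : ℕ, Nonempty (FractionRing (MvPolynomial (Fin n) (actionFixedField σ)) ≃ₐ[F]
      actionFixedField τ) := by
  set W := Submodule.span L (Set.range x)
  have hWstable : ∀ g, ∀ v ∈ W, τ g v ∈ W := by
    intro g v hv
    induction hv using Submodule.span_induction with
    | mem v hv => obtain ⟨i, rfl⟩ := hv; exact hstable g i
    | zero => simp
    | add v v' _ _ hv hv' => rw [map_add]; exact W.add_mem hv hv'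
    | smul l v _ hv =>
      rw [Algebra.smul_def, map_mul, hστ, ← Algebra.smul_def]
      exact W.smul_mem _ hv
  obtain ⟨B, hBsub, hBspan, hBli⟩ := exists_linearIndependent L
    {v | v ∈ W ∧ ∃ χ : G →* Fˣ, ∀ g, τ g v = (χ g : F) • v}
  have hWB : W ≤ Submodule.span L B := by
    rw [hBspan]
    exact le_span_eigenvectors σ τ hστ hsep W hWstable
  have hBW : Submodule.span L (Set.range ((↑) : B → K)) = W := by
    rw [Subtype.range_val]
    exact le_antisymm (Submodule.span_le.mpr fun v hv => (hBsub hv).1) hWB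
  have hWfin : FiniteDimensional L W := FiniteDimensional.span_of_finite L (Set.finite_range x)
  let bB : Module.Basis B L W := (Module.Basis.span hBli).map (LinearEquiv.ofEq _ _ hBW)
  have hBfin : Finite B := Module.Finite.finite_basis bB
  have hcard : Nat.card B = Nat.card ι := by
    rw [← Module.finrank_eq_nat_card_basis bB,
      ← Module.finrank_eq_nat_card_basis (Module.Basis.span hx.linearIndependent)]
  have hBgen : IntermediateField.adjoin L (Set.range ((↑) : B → K)) = ⊤ := by
    rw [eq_top_iff, ← hgen, IntermediateField.adjoin_le_iff]
    intro v hv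
    have hle : Submodule.span L (Set.range ((↑) : B → K)) ≤
        (IntermediateField.adjoin L (Set.range ((↑) : B → K))).toSubalgebra.toSubmodule :=
      Submodule.span_le.mpr (IntermediateField.subset_adjoin _ _)
    rw [hBW] at hle
    exact hle (Submodule.subset_span hv)
  have : Algebra.IsAlgebraic (IntermediateField.adjoin L (Set.range ((↑) : B → K))) K := by
    constructor
    intro u
    exact isAlgebraic_algebraMap
      (⟨u, hBgen ▸ trivial⟩ : IntermediateField.adjoin L (Set.range ((↑) : B → K)))
  have hBind := hx.of_card_le_of_isAlgebraic ((↑) : B → K) hcard.le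
  choose χ hχ using fun v : B => (hBsub v.2).2
  obtain ⟨n, w, hw, hwgen⟩ := exists_generators_of_eigenvectors σ τ hστ hBind hBgen χ hχ
  have hw' : AlgebraicIndependent (actionFixedField σ) w :=
    hw.restrictScalars (algebraMap (actionFixedField σ) L).injective
  refine ⟨n, ⟨(hw'.aevalEquivField.restrictScalars F).trans ?_⟩⟩
  exact IntermediateField.equivOfEq
    (S := (IntermediateField.adjoin (actionFixedField σ) (Set.range w)).restrictScalars F)
    (SetLike.ext hwgen)

end RationalInvariants

/-! ### Functoriality of the field `F(M)` -/

section LatticeFields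

variable (F : Type*) {A B : Type*} [Field F] [AddCommGroup A] [AddCommGroup B]
  {G : Type*} [Group G]

/-- The element `x^m` of `F(M)`. -/
noncomputable def latticeMonomial (m : A) : LatticeField F A :=
  algebraMap (AddMonoidAlgebra F A) _ (AddMonoidAlgebra.single m 1)

theorem latticeMonomial_zero : latticeMonomial F (0 : A) = 1 :=
  map_one (algebraMap (AddMonoidAlgebra F A) _)

theorem latticeMonomial_add (a b : A) :
    latticeMonomial F (a + b) = latticeMonomial F a * latticeMonomial F b := by
  rw [latticeMonomial, latticeMonomial, latticeMonomial, ← map_mul,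
    AddMonoidAlgebra.single_mul_single, one_mul]

theorem latticeFieldAut_latticeMonomial (ρ : Representation ℤ G A) (g : G) (a : A) :
    latticeFieldAut F ρ g (latticeMonomial F a) = latticeMonomial F (ρ g a) := by
  simp [latticeFieldAut, latticeMonomial, groupAlgebraAut, moduleAut]

theorem latticeMonomial_ne_zero (a : A) : latticeMonomial F a ≠ 0 := by
  intro h
  have := latticeMonomial_add F a (-a)
  rw [add_neg_cancel, h, zero_mul, latticeMonomial_zero] at this
  exact one_ne_zero this

theorem latticeMonomial_sum {ι : Type*} (s : Finset ι) (f : ι → A) :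
    latticeMonomial F (∑ i ∈ s, f i) = ∏ i ∈ s, latticeMonomial F (f i) := by
  classical
  induction s using Finset.induction_on with
  | empty => simp [latticeMonomial_zero]
  | insert i s hi ih => rw [Finset.sum_insert hi, Finset.prod_insert hi, latticeMonomial_add, ih]

theorem latticeMonomial_injective :
    Function.Injective (latticeMonomial F : A → LatticeField F A) := by
  intro a b h
  have h' := IsFractionRing.injective (AddMonoidAlgebra F A) (LatticeField F A) h
  exact AddMonoidAlgebra.of_injective (R := F) (M := A) h'

variable {F} in
/-- A homomorphism from `F(A)` to a field is determined by its values on the monomials. -/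
theorem LatticeField.algHom_ext {K : Type*} [Field K] [Algebra F K]
    {f g : LatticeField F A →ₐ[F] K}
    (h : ∀ a, f (latticeMonomial F a) = g (latticeMonomial F a)) : f = g := by
  have h1 : f.comp (IsScalarTower.toAlgHom F (AddMonoidAlgebra F A) (LatticeField F A)) =
      g.comp (IsScalarTower.toAlgHom F (AddMonoidAlgebra F A) (LatticeField F A)) :=
    AddMonoidAlgebra.algHom_ext (fun a => h a) (Subsingleton.elim _ _)
  have h2 : (f : LatticeField F A →+* K) = g :=
    IsLocalization.ringHom_ext (nonZeroDivisors (AddMonoidAlgebra F A))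
      (RingHom.ext fun x => AlgHom.congr_fun h1 x)
  exact AlgHom.ext fun x => RingHom.congr_fun h2 x

theorem groupAlgebra_algHom_injective (f : A →+ B) (hf : Function.Injective f) :
    Function.Injective ((IsScalarTower.toAlgHom F (AddMonoidAlgebra F B) (LatticeField F B)).comp
      (AddMonoidAlgebra.mapDomainAlgHom F F f)) :=
  (IsFractionRing.injective (AddMonoidAlgebra F B) (LatticeField F B)).comp
    (AddMonoidAlgebra.mapDomain_injective hf)

variable [Module.Free ℤ A] [Module.Free ℤ B]

theorem latticeMonomial_zsmul (n : ℤ) (a : A) :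
    latticeMonomial F (n • a) = latticeMonomial F a ^ n := by
  induction n using Int.induction_on with
  | zero => simp [latticeMonomial_zero]
  | succ n ih =>
    rw [add_smul, one_smul, latticeMonomial_add, ih, zpow_add_one₀ (latticeMonomial_ne_zero F a)]
  | pred n ih =>
    rw [zpow_sub_one₀ (latticeMonomial_ne_zero F a), ← ih,
      eq_mul_inv_iff_mul_eq₀ (latticeMonomial_ne_zero F a), ← latticeMonomial_add, sub_smul,
      one_smul, sub_add_cancel]

theorem adjoin_range_latticeMonomial :
    IntermediateField.adjoin F (Set.range (latticeMonomial F : A → LatticeField F A)) = ⊤ := by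
  rw [eq_top_iff]
  rintro u -
  have key : ∀ p : AddMonoidAlgebra F A, algebraMap _ (LatticeField F A) p ∈
      IntermediateField.adjoin F (Set.range (latticeMonomial F : A → LatticeField F A)) := by
    intro p
    induction p using AddMonoidAlgebra.induction_linear with
    | zero => simp
    | add p q hp hq => rw [map_add]; exact add_mem hp hq
    | single a r =>
      have h : AddMonoidAlgebra.single a r = r • AddMonoidAlgebra.single a (1 : F) := by simp
      rw [h, ← IsScalarTower.coe_toAlgHom' F, map_smul]
      exact IntermediateField.smul_mem _
        (IntermediateField.subset_adjoin F (Set.range (latticeMonomial F)) ⟨a, rfl⟩)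
  obtain ⟨p, q, -, rfl⟩ := IsFractionRing.div_surjective (AddMonoidAlgebra F A) u
  exact div_mem (key p) (key q)

/-- The embedding `F(A) → F(B)` induced by an injective homomorphism `A → B`. -/
noncomputable def latticeFieldMap (f : A →+ B) (hf : Function.Injective f) :
    LatticeField F A →ₐ[F] LatticeField F B :=
  IsFractionRing.liftAlgHom (groupAlgebra_algHom_injective F f hf)

theorem latticeFieldMap_algebraMap (f : A →+ B) (hf : Function.Injective f)
    (p : AddMonoidAlgebra F A) :
    latticeFieldMap F f hf (algebraMap _ _ p) =
      algebraMap _ _ (AddMonoidAlgebra.mapDomainAlgHom F F f p) :=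
  IsFractionRing.lift_algebraMap (groupAlgebra_algHom_injective F f hf) p

theorem latticeFieldMap_latticeMonomial (f : A →+ B) (hf : Function.Injective f) (a : A) :
    latticeFieldMap F f hf (latticeMonomial F a) = latticeMonomial F (f a) := by
  rw [latticeMonomial, latticeFieldMap_algebraMap]
  simp [latticeMonomial]

/-- The action of `G` on the field `F(M)`. -/
noncomputable def latticeFieldAction (ρ : Representation ℤ G A) :
    G →* (LatticeField F A ≃ₐ[F] LatticeField F A) where
  toFun := latticeFieldAut F ρ
  map_one' := by
    refine AlgEquiv.coe_toAlgHom_injective (LatticeField.algHom_ext fun a => ?_)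
    simp [latticeFieldAut_latticeMonomial]
  map_mul' g h := by
    refine AlgEquiv.coe_toAlgHom_injective (LatticeField.algHom_ext fun a => ?_)
    simp [latticeFieldAut_latticeMonomial]

theorem invariantField_eq_actionFixedField (ρ : Representation ℤ G A) :
    invariantField F ρ = actionFixedField (latticeFieldAction F ρ) :=
  SetLike.ext fun _ => (mem_actionFixedField (τ := latticeFieldAction F ρ)).symm

theorem apply_eq_of_latticeFieldAction_eq {ρ : Representation ℤ G A} {g : G}
    (h : ∀ l, latticeFieldAction F ρ g l = l) (a : A) : ρ g a = a := by
  have := h (latticeMonomial F a)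
  change latticeFieldAut F ρ g _ = _ at this
  rw [latticeFieldAut_latticeMonomial] at this
  exact latticeMonomial_injective F this

theorem latticeFieldAut_latticeFieldMap {ρ : Representation ℤ G A} {ρ' : Representation ℤ G B}
    (f : A →+ B) (hf : Function.Injective f) (h : ∀ g a, ρ' g (f a) = f (ρ g a)) (g : G)
    (x : LatticeField F A) :
    latticeFieldAut F ρ' g (latticeFieldMap F f hf x) =
      latticeFieldMap F f hf (latticeFieldAut F ρ g x) := by
  have h' : (latticeFieldAut F ρ' g : LatticeField F B →ₐ[F] LatticeField F B).comp
      (latticeFieldMap F f hf) = (latticeFieldMap F f hf).comp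
        (latticeFieldAut F ρ g : LatticeField F A →ₐ[F] LatticeField F A) := by
    refine LatticeField.algHom_ext fun a => ?_
    simp [latticeFieldAut_latticeMonomial, latticeFieldMap_latticeMonomial, h]
  exact AlgHom.congr_fun h' x

/-- An isomorphism of lattices that is compatible with a surjection of the acting groups induces an
isomorphism of the fields of invariants. -/
theorem nonempty_invariantField_equiv {G' : Type*} [Group G'] {ρ : Representation ℤ G A}
    {ρ' : Representation ℤ G' B} (φ : G →* G') (hφ : Function.Surjective φ) (e : A ≃+ B)
    (he : ∀ g a, e (ρ g a) = ρ' (φ g) (e a)) :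
    Nonempty (invariantField F ρ ≃ₐ[F] invariantField F ρ') := by
  let θ : LatticeField F A ≃ₐ[F] LatticeField F B :=
    IsFractionRing.algEquivOfAlgEquiv (AddMonoidAlgebra.domCongr F F e)
  have hθ : ∀ a, θ (latticeMonomial F a) = latticeMonomial F (e a) := by
    intro a
    simp [θ, latticeMonomial]
  have hcomm : ∀ g x, θ (latticeFieldAut F ρ g x) = latticeFieldAut F ρ' (φ g) (θ x) := by
    intro g x
    have h : (θ : LatticeField F A →ₐ[F] LatticeField F B).comp (latticeFieldAut F ρ g) =
        (latticeFieldAut F ρ' (φ g) : LatticeField F B →ₐ[F] LatticeField F B).comp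
          (θ : LatticeField F A →ₐ[F] LatticeField F B) := by
      refine LatticeField.algHom_ext fun a => ?_
      simp [hθ, latticeFieldAut_latticeMonomial, he]
    exact AlgHom.congr_fun h x
  refine ⟨(IntermediateField.intermediateFieldMap θ (invariantField F ρ)).trans
    (IntermediateField.equivOfEq (SetLike.ext fun y => ?_))⟩
  rw [IntermediateField.mem_map]
  constructor
  · rintro ⟨x, hx, rfl⟩ g'
    obtain ⟨g, rfl⟩ := hφ g'
    exact (hcomm g x).symm.trans (congrArg θ (hx g))
  · intro hy
    refine ⟨θ.symm y, fun g => θ.injective ?_, θ.apply_symm_apply y⟩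
    rw [hcomm, θ.apply_symm_apply]
    exact hy (φ g)

end LatticeFields

/-! ### Adjoining a permutation lattice -/

section PermutationLattices

variable (F : Type*) {A E G : Type*} [Field F] [AddCommGroup A] [Finite E] [DecidableEq E]

theorem inl_injective (A B : Type*) [AddCommGroup A] [AddCommGroup B] :
    Function.Injective (AddMonoidHom.inl A B) :=
  fun _ _ h => congrArg Prod.fst h

/-- Evaluation of polynomials with coefficients in `F[A]` at the variables of `F[A ⊕ ℤE]`. -/
noncomputable def groupAlgebraEval (A : Type*) [AddCommGroup A] :
    MvPolynomial E (AddMonoidAlgebra F A) →+* AddMonoidAlgebra F (A × (E → ℤ)) :=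
  MvPolynomial.eval₂Hom
    (AddMonoidAlgebra.mapDomainAlgHom F F (AddMonoidHom.inl A (E → ℤ))).toRingHom
    fun e => AddMonoidAlgebra.single (0, Pi.single e 1) 1

theorem groupAlgebraEval_monomial (β : E →₀ ℕ) (c : AddMonoidAlgebra F A) :
    groupAlgebraEval F A (MvPolynomial.monomial β c) =
      AddMonoidAlgebra.mapDomainAlgHom F F (AddMonoidHom.inl A (E → ℤ)) c *
        AddMonoidAlgebra.single (0, fun e => (β e : ℤ)) 1 := by
  cases nonempty_fintype E
  rw [groupAlgebraEval, MvPolynomial.coe_eval₂Hom, MvPolynomial.eval₂_monomial,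
    Finsupp.prod_fintype _ _ fun _ => pow_zero _]
  congr 1
  simp only [AddMonoidAlgebra.single_pow, one_pow]
  rw [AddMonoidAlgebra.prod_single]
  congr 1
  · refine Prod.ext (by simp [Prod.fst_sum]) (funext fun e => ?_)
    simp [Prod.snd_sum, Finset.sum_apply, Pi.single_apply]
  · simp

/-- The coefficients of a polynomial can be read off from its value, since distinct exponents in
`ℕ^E` remain distinct in `ℤ^E`. -/
theorem coeff_groupAlgebraEval (p : MvPolynomial E (AddMonoidAlgebra F A)) (β : E →₀ ℕ) (a : A) :
    (groupAlgebraEval F A p).coeff (a, fun e => (β e : ℤ)) = (p.coeff β).coeff a := by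
  induction p using MvPolynomial.induction_on' with
  | add p q hp hq => simp [map_add, hp, hq]
  | monomial γ c =>
    rw [groupAlgebraEval_monomial, AddMonoidAlgebra.coeff_mul_single_apply,
      MvPolynomial.coeff_monomial]
    split_ifs with h
    · subst h
      simp only [mul_one]
      convert Finsupp.mapDomain_apply (inl_injective A (E → ℤ)) c.coeff a using 1
      simp
    · simp only [mul_one]
      refine Finsupp.mapDomain_of_notMem_range c.coeff _ ?_
      rintro ⟨a', ha'⟩
      refine h (Finsupp.ext fun e => ?_)
      have := congrFun (congrArg Prod.snd ha') e
      simp at this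
      omega

theorem groupAlgebraEval_injective :
    Function.Injective (groupAlgebraEval F A (E := E)) := by
  rw [injective_iff_map_eq_zero]
  intro p hp
  ext β a
  rw [← coeff_groupAlgebraEval, hp]
  simp

variable [Module.Free ℤ A]

/-- `F(A ⊕ B)` as an extension of `F(A)`. -/
@[reducible]
noncomputable def latticeFieldAlgebra (A B : Type*) [AddCommGroup A] [AddCommGroup B]
    [Module.Free ℤ A] [Module.Free ℤ B] : Algebra (LatticeField F A) (LatticeField F (A × B)) :=
  (latticeFieldMap F (AddMonoidHom.inl A B) (inl_injective A B)).toRingHom.toAlgebra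

attribute [local instance] latticeFieldAlgebra

theorem latticeField_algebraMap_eq (B : Type*) [AddCommGroup B] [Module.Free ℤ B] :
    ⇑(algebraMap (LatticeField F A) (LatticeField F (A × B))) =
      latticeFieldMap F (AddMonoidHom.inl A B) (inl_injective A B) :=
  rfl

theorem latticeField_isScalarTower (B : Type*) [AddCommGroup B] [Module.Free ℤ B] :
    IsScalarTower F (LatticeField F A) (LatticeField F (A × B)) :=
  .of_algebraMap_eq fun x =>
    ((latticeFieldMap F (AddMonoidHom.inl A B) (inl_injective A B)).commutes x).symm

/-- The variable of `F(A ⊕ ℤE)` belonging to a point of `E`. -/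
noncomputable def latticeVariable (A : Type*) [AddCommGroup A] (e : E) :
    LatticeField F (A × (E → ℤ)) :=
  latticeMonomial F (0, Pi.single e 1)

theorem adjoin_range_latticeVariable :
    IntermediateField.adjoin (LatticeField F A) (Set.range (latticeVariable F A (E := E))) = ⊤ := by
  cases nonempty_fintype E
  have := latticeField_isScalarTower F (A := A) (E → ℤ)
  set T := IntermediateField.adjoin (LatticeField F A) (Set.range (latticeVariable F A (E := E)))
  have hT : T.restrictScalars F = ⊤ := by
    rw [eq_top_iff, ← adjoin_range_latticeMonomial F, IntermediateField.adjoin_le_iff]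
    rintro _ ⟨⟨a, b⟩, rfl⟩
    have hab : ((a, b) : A × (E → ℤ)) = (a, 0) + ∑ e, b e • (0, Pi.single e 1) := by
      refine Prod.ext (by simp [Prod.fst_sum]) (funext fun e => ?_)
      simp [Prod.snd_sum, Finset.sum_apply, Pi.single_apply]
    rw [hab, latticeMonomial_add, latticeMonomial_sum]
    refine mul_mem ?_ (prod_mem fun e _ => ?_)
    · have h := latticeFieldMap_latticeMonomial F (AddMonoidHom.inl A (E → ℤ))
        (inl_injective A (E → ℤ)) a
      rw [AddMonoidHom.inl_apply, ← latticeField_algebraMap_eq] at h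
      rw [← h]
      exact T.algebraMap_mem _
    · rw [latticeMonomial_zsmul]
      exact zpow_mem (IntermediateField.subset_adjoin (LatticeField F A)
        (Set.range (latticeVariable F A (E := E))) ⟨e, rfl⟩) _
  exact eq_top_iff.mpr fun u _ => hT.ge trivial

theorem algebraicIndependent_latticeVariable :
    AlgebraicIndependent (LatticeField F A) (latticeVariable F A (E := E)) := by
  let _ : Algebra (AddMonoidAlgebra F A) (LatticeField F (A × (E → ℤ))) :=
    ((algebraMap (LatticeField F A) (LatticeField F (A × (E → ℤ)))).comp
      (algebraMap (AddMonoidAlgebra F A) (LatticeField F A))).toAlgebra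
  have : IsScalarTower (AddMonoidAlgebra F A) (LatticeField F A)
    (LatticeField F (A × (E → ℤ))) := .of_algebraMap_eq' rfl
  have : Algebra.IsAlgebraic (AddMonoidAlgebra F A) (LatticeField F A) :=
    IsLocalization.isAlgebraic _ (nonZeroDivisors (AddMonoidAlgebra F A))
  -- independence over `F[A]` suffices, since `F(A)` is algebraic over it
  have h : AlgebraicIndependent (AddMonoidAlgebra F A) (latticeVariable F A (E := E)) := by
    rw [algebraicIndependent_iff_injective_aeval]
    have : ⇑(MvPolynomial.aeval (R := AddMonoidAlgebra F A) (latticeVariable F A (E := E))) =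
        algebraMap (AddMonoidAlgebra F (A × (E → ℤ))) (LatticeField F (A × (E → ℤ))) ∘
          groupAlgebraEval F A := by
      have h' : (MvPolynomial.aeval (R := AddMonoidAlgebra F A)
          (latticeVariable F A (E := E))).toRingHom =
            (algebraMap (AddMonoidAlgebra F (A × (E → ℤ))) _).comp (groupAlgebraEval F A) := by
        refine MvPolynomial.ringHom_ext (fun p => ?_) fun e => ?_
        · simp [groupAlgebraEval]
          exact latticeFieldMap_algebraMap F _ (inl_injective A (E → ℤ)) p
        · simp [groupAlgebraEval, latticeVariable, latticeMonomial]
      exact congrArg DFunLike.coe h'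
    rw [this]
    exact (IsFractionRing.injective _ _).comp (groupAlgebraEval_injective F)
  exact h.extendScalars _

variable [Group G] [MulAction G E] [CharZero F] [Finite G]

/-- Adding a permutation lattice `ℤE` to a lattice `A` replaces the field of invariants by a purely
transcendental extension, provided that the characters of `G` with values in `F` separate the
elements of the kernel of the action on `A`. -/
theorem exists_fractionRing_equiv_invariantField (ρ : Representation ℤ G A)
    (hsep : ∀ g, (∀ a, ρ g a = a) → (∀ χ : G →* Fˣ, χ g = 1) → g = 1) :
    ∃ n : ℕ, Nonempty (FractionRing (MvPolynomial (Fin n) (invariantField F ρ)) ≃ₐ[F]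
      invariantField F (ρ.prod (permutationRep G E))) := by
  have := latticeField_isScalarTower F (A := A) (E → ℤ)
  rw [invariantField_eq_actionFixedField, invariantField_eq_actionFixedField]
  refine exists_fractionRing_equiv_actionFixedField _ _ ?_
    (fun g hg => hsep g (apply_eq_of_latticeFieldAction_eq F hg))
    (algebraicIndependent_latticeVariable F) (adjoin_range_latticeVariable F) ?_
  · intro g l
    exact latticeFieldAut_latticeFieldMap F _ (inl_injective A (E → ℤ)) (by simp) g l
  · intro g e
    refine Submodule.subset_span ⟨g • e, ?_⟩
    change _ = latticeFieldAut F _ g (latticeMonomial F _)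
    rw [latticeFieldAut_latticeMonomial, latticeVariable]
    congr 1
    refine Prod.ext (by simp) (funext fun e' => ?_)
    simp [permutationRep, LinearMap.funLeft, Pi.single_apply, inv_smul_eq_iff]

end PermutationLattices

/-! ### Flows and change of vertices -/

section Flows

variable {V V' : Type*}

/-- A bijection between vertex sets induces one between the edges of the complete loopless
graphs. -/
def LooplessEdge.congr (ε : V ≃ V') : LooplessEdge V ≃ LooplessEdge V' :=
  (Equiv.prodCongr ε ε).subtypeEquiv fun p => by simp

/-- Sums over the edges at a vertex, for an end `s` of the edges that is respected by the bijection
of the vertices. -/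
theorem finsum_looplessEdge_congr (ε : V ≃ V') (s : V × V → V) (s' : V' × V' → V')
    (hs : ∀ p, s' (ε p.1, ε p.2) = ε (s p)) (f : LooplessEdge V → ℤ) (v' : V') :
    ∑ᶠ e ∈ {e : LooplessEdge V' | s' e.1 = v'}, f ((LooplessEdge.congr ε).symm e) =
      ∑ᶠ e ∈ {e : LooplessEdge V | s e.1 = ε.symm v'}, f e := by
  symm
  refine finsum_mem_eq_of_bijOn (LooplessEdge.congr ε) ⟨?_, ?_, ?_⟩ fun e _ => by simp
  · intro e he
    have he' : s e.1 = ε.symm v' := he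
    change s' (ε e.1.1, ε e.1.2) = v'
    rw [hs, he', ε.apply_symm_apply]
  · exact (LooplessEdge.congr ε).injective.injOn
  · intro e he
    refine ⟨(LooplessEdge.congr ε).symm e, ?_, Equiv.apply_symm_apply _ _⟩
    obtain ⟨e, rfl⟩ := (LooplessEdge.congr ε).surjective e
    have he' : s' (ε e.1.1, ε e.1.2) = v' := he
    change s ((LooplessEdge.congr ε).symm _).1 = _
    rw [Equiv.symm_apply_apply, Equiv.eq_symm_apply, ← hs, he']

variable [Finite V] [Finite V']

theorem comp_congr_symm_mem_flows (ε : V ≃ V') {f : LooplessEdge V → ℤ}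
    (hf : f ∈ (completeLooplessGraph V).flows) :
    f ∘ (LooplessEdge.congr ε).symm ∈ (completeLooplessGraph V').flows := fun v' =>
  (finsum_looplessEdge_congr ε Prod.fst Prod.fst (fun _ => rfl) f v').trans
    ((hf _).trans (finsum_looplessEdge_congr ε Prod.snd Prod.snd (fun _ => rfl) f v').symm)

/-- The isomorphism of flow lattices induced by a bijection of vertex sets. -/
def flowsCongr (ε : V ≃ V') :
    (completeLooplessGraph V).flows ≃+ (completeLooplessGraph V').flows where
  toFun f := ⟨f.1 ∘ (LooplessEdge.congr ε).symm, comp_congr_symm_mem_flows ε f.2⟩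
  invFun f := ⟨f.1 ∘ (LooplessEdge.congr ε), comp_congr_symm_mem_flows ε.symm f.2⟩
  left_inv f := Subtype.ext (funext fun e => by simp)
  right_inv f := Subtype.ext (funext fun e => by simp)
  map_add' _ _ := rfl

theorem flowsCongr_flowRep {G G' : Type*} [Group G] [Group G'] [MulAction G V] [MulAction G' V']
    (φ : G →* G') (ε : V ≃ V') (hε : ∀ (g : G) v, ε (g • v) = φ g • ε v) (g : G)
    (f : (completeLooplessGraph V).flows) :
    flowsCongr ε ((completeLooplessGraph V).flowRep G g f) =
      (completeLooplessGraph V').flowRep G' (φ g) (flowsCongr ε f) := by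
  refine Subtype.ext (funext fun e' => ?_)
  obtain ⟨e, rfl⟩ := (LooplessEdge.congr ε).surjective e'
  have h : (φ g)⁻¹ • LooplessEdge.congr ε e = LooplessEdge.congr ε (g⁻¹ • e) := by
    rw [← map_inv]
    exact Subtype.ext (Prod.ext (hε _ _).symm (hε _ _).symm)
  change f.1 (g⁻¹ • (LooplessEdge.congr ε).symm _) =
    f.1 ((LooplessEdge.congr ε).symm ((φ g)⁻¹ • LooplessEdge.congr ε e))
  rw [h, Equiv.symm_apply_apply, Equiv.symm_apply_apply]

end Flows

/-! ### The group theory of `N ⋊ H` -/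

section GroupTheory

variable {G : Type*} [Group G]

/-- The kernel of the action on `G/H` is the normal core of `H`. It is central: it commutes with `N`,
being a normal subgroup disjoint from `N`, and with the commutative group `H`. -/
theorem toPermHom_ker_eq_inf_center {N H : Subgroup G} (hNnormal : N.Normal)
    (hNH : N.IsComplement' H) (hH : ∀ a ∈ H, ∀ b ∈ H, a * b = b * a) :
    (MulAction.toPermHom G (G ⧸ H)).ker = H ⊓ Subgroup.center G := by
  rw [← Subgroup.normalCore_eq_ker]
  refine le_antisymm (fun c hc => ?_) (Subgroup.normal_le_normalCore.mpr inf_le_left)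
  have hcH := H.normalCore_le hc
  refine ⟨hcH, Subgroup.mem_center_iff.mpr fun g => ?_⟩
  obtain ⟨⟨⟨n, hn⟩, ⟨h, hh⟩⟩, rfl⟩ := hNH.2 g
  have hcn : Commute n c := Subgroup.commute_of_normal_of_disjoint N H.normalCore hNnormal
    inferInstance (hNH.disjoint.mono_right H.normalCore_le) n c hn hc
  exact (hcn.mul_left (hH h hh c hcH)).eq

/-- The characters of `G` that factor through `G/N ≅ H` separate the elements of `H`. -/
theorem exists_character_apply_ne_one {F : Type*} [Field F] [Finite G]
    (hF : ∃ ζ : F, IsPrimitiveRoot ζ (Nat.card G)) {N H : Subgroup G} (hNnormal : N.Normal)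
    (hNH : N.IsComplement' H) (hH : ∀ a ∈ H, ∀ b ∈ H, a * b = b * a) {h : G} (hh : h ∈ H)
    (h1 : h ≠ 1) : ∃ χ : G →* Fˣ, χ h ≠ 1 := by
  let _ : CommGroup H := { mul_comm := fun a b => Subtype.ext (hH a a.2 b b.2) }
  have : NeZero (Nat.card G) := ⟨Nat.card_pos.ne'⟩
  have : HasEnoughRootsOfUnity F (Nat.card G) := ⟨hF, inferInstance⟩
  have : HasEnoughRootsOfUnity F (Monoid.exponent H) :=
    HasEnoughRootsOfUnity.of_dvd F (Group.exponent_dvd_nat_card.trans H.card_subgroup_dvd_card)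
  obtain ⟨ψ, hψ⟩ := CommGroup.exists_apply_ne_one_of_hasEnoughRootsOfUnity H F
    (a := ⟨h, hh⟩) (by simpa [Subtype.ext_iff] using h1)
  let θ : G ⧸ N ≃* H := hNH.symm.QuotientMulEquiv
  refine ⟨ψ.comp (θ.toMonoidHom.comp (QuotientGroup.mk' N)), ?_⟩
  have hθ : θ (QuotientGroup.mk' N h) = ⟨h, hh⟩ := by
    rw [← θ.eq_symm_apply]
    rfl
  change ψ (θ (QuotientGroup.mk' N h)) ≠ 1
  rwa [hθ]

/-- The vertex set `G/H` does not change when a normal subgroup contained in `H` is factored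
out. -/
theorem exists_quotient_equiv_map_mk' (H K : Subgroup G) [K.Normal] (hKH : K ≤ H) :
    ∃ ε : G ⧸ H ≃ (G ⧸ K) ⧸ H.map (QuotientGroup.mk' K),
      ∀ (g : G) v, ε (g • v) = QuotientGroup.mk' K g • ε v := by
  have hmem : ∀ a : G, QuotientGroup.mk' K a ∈ H.map (QuotientGroup.mk' K) ↔ a ∈ H := by
    intro a
    rw [← Subgroup.mem_comap, Subgroup.comap_map_eq_self]
    simpa using hKH
  have hrel : ∀ a b : G, (QuotientGroup.mk (QuotientGroup.mk' K a) :
      (G ⧸ K) ⧸ H.map (QuotientGroup.mk' K)) = QuotientGroup.mk (QuotientGroup.mk' K b) ↔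
      (QuotientGroup.mk a : G ⧸ H) = QuotientGroup.mk b := by
    intro a b
    rw [QuotientGroup.eq, QuotientGroup.eq, ← map_inv, ← map_mul, hmem]
  let f : G ⧸ H → (G ⧸ K) ⧸ H.map (QuotientGroup.mk' K) :=
    Quotient.lift (fun a => QuotientGroup.mk (QuotientGroup.mk' K a)) fun a b hab =>
      (hrel a b).mpr (Quotient.sound hab)
  refine ⟨Equiv.ofBijective f ⟨?_, ?_⟩, ?_⟩
  · rintro ⟨a⟩ ⟨b⟩ hab
    exact (hrel a b).mp hab
  · rintro ⟨⟨a⟩⟩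
    exact ⟨QuotientGroup.mk a, rfl⟩
  · rintro g ⟨a⟩
    rfl

end GroupTheory

/-! ### Stable isomorphism of the two invariant fields -/

section StableIsomorphism

/-- An element that acts trivially on the permutation lattice of a quotient group fixes the
indicator function of the identity, and so has trivial image. -/
theorem eq_one_of_permutationRep_eq {G Q : Type*} [Group G] [Group Q] [MulAction G Q] (φ : G →* Q)
    (hφ : ∀ (g : G) (q : Q), g • q = φ g * q) (g : G)
    (h : ∀ f, permutationRep G Q g f = f) : φ g = 1 := by
  classical
  have h1 := congrFun (h (Pi.single 1 1)) (φ g)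
  change (Pi.single 1 1 : Q → ℤ) (g⁻¹ • φ g) = (Pi.single 1 1 : Q → ℤ) (φ g) at h1
  rw [hφ, map_inv, inv_mul_cancel, Pi.single_eq_same] at h1
  by_contra hne
  rw [Pi.single_eq_of_ne hne] at h1
  exact one_ne_zero h1

theorem StablyIsomorphic.of_equiv_right {F L₁ L₂ L₃ : Type*} [Field F] [Field L₁] [Field L₂]
    [Field L₃] [Algebra F L₁] [Algebra F L₂] [Algebra F L₃] (h : StablyIsomorphic F L₁ L₂)
    (e : L₂ ≃ₐ[F] L₃) : StablyIsomorphic F L₁ L₃ := by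
  obtain ⟨m, k, ⟨θ⟩⟩ := h
  exact ⟨m, k, ⟨θ.trans (IsFractionRing.algEquivOfAlgEquiv (MvPolynomial.mapAlgEquiv (Fin k) e))⟩⟩

/-- Factoring out a normal subgroup `K ≤ H` whose elements are separated by characters of `G` does
not change the field of invariants, up to stable isomorphism: both fields are compared with the
invariants of `F(Fl(X) ⊕ ℤG ⊕ ℤ(G/K))`. -/
theorem stablyIsomorphic_flowField {F : Type*} [Field F] [CharZero F] {G : Type*} [Group G]
    [Finite G] (H K : Subgroup G) [K.Normal] (hKH : K ≤ H)
    (hχ : ∀ h ∈ K, h ≠ 1 → ∃ χ : G →* Fˣ, χ h ≠ 1) :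
    StablyIsomorphic F (flowField F G H) (flowField F (G ⧸ K) (H.map (QuotientGroup.mk' K))) := by
  classical
  obtain ⟨ε, hε⟩ := exists_quotient_equiv_map_mk' H K hKH
  let π := QuotientGroup.mk' K
  let ρ₁ := ((completeLooplessGraph (G ⧸ H)).flowRep G).prod (permutationRep G G)
  let ρ₂ := ((completeLooplessGraph ((G ⧸ K) ⧸ H.map π)).flowRep (G ⧸ K)).prod
    (permutationRep (G ⧸ K) (G ⧸ K))
  let ρ₂' : Representation ℤ G _ := ρ₂.comp π
  obtain ⟨m, ⟨θ₁⟩⟩ := exists_fractionRing_equiv_invariantField F (E := G ⧸ K) ρ₁ fun g hg _ => by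
    refine eq_one_of_permutationRep_eq (MonoidHom.id G) (fun _ _ => rfl) g fun f => ?_
    exact congrArg Prod.snd (hg (0, f))
  obtain ⟨k, ⟨θ₂⟩⟩ := exists_fractionRing_equiv_invariantField F (E := G) ρ₂' fun g hg hg' => by
    by_contra hne
    have hgK : g ∈ K := by
      rw [← QuotientGroup.eq_one_iff]
      refine eq_one_of_permutationRep_eq (MonoidHom.id (G ⧸ K)) (fun _ _ => rfl) _ fun f => ?_
      exact congrArg Prod.snd (hg (0, f))
    obtain ⟨χ, hχ⟩ := hχ g hgK hne
    exact hχ (hg' χ)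
  let e : ((completeLooplessGraph (G ⧸ H)).flows × (G → ℤ)) × (G ⧸ K → ℤ) ≃+
      ((completeLooplessGraph ((G ⧸ K) ⧸ H.map π)).flows × (G ⧸ K → ℤ)) × (G → ℤ) :=
    { toFun := fun x => ((flowsCongr ε x.1.1, x.2), x.1.2)
      invFun := fun x => (((flowsCongr ε).symm x.1.1, x.2), x.1.2)
      left_inv := fun x => by simp
      right_inv := fun x => by simp
      map_add' := fun x y => by simp }
  obtain ⟨θ⟩ := nonempty_invariantField_equiv F (ρ := ρ₁.prod (permutationRep G (G ⧸ K)))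
    (ρ' := ρ₂'.prod (permutationRep G G)) (MonoidHom.id G) Function.surjective_id e
    fun g x => Prod.ext (Prod.ext (flowsCongr_flowRep π ε hε g x.1.1) rfl) rfl
  obtain ⟨θ₃⟩ := nonempty_invariantField_equiv F (ρ := ρ₂') (ρ' := ρ₂) π
    (QuotientGroup.mk'_surjective K) (AddEquiv.refl _) fun _ _ => rfl
  exact StablyIsomorphic.of_equiv_right ⟨m, k, ⟨(θ₁.trans θ).trans θ₂.symm⟩⟩ θ₃

end StableIsomorphism

/-- Let `G = N ⋊ H` be a finite semidirect product of abelian groups and let `F` be a field of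
characteristic zero containing a primitive root of unity of order `|G|`. Then the kernel of the
action of `G` on `G/H` is `H ∩ Z(G)`, and, with `G̃ = G/(H ∩ Z(G))` and `H̃` the image of `H`,
the fields `F(Fl(X) ⊕ ℤG)^G` and `F(Fl(X̃) ⊕ ℤG̃)^G̃` are stably isomorphic over `F`, where `X`
and `X̃` are the complete loopless graphs on `G/H` and `G̃/H̃`. -/
theorem mainTheorem6 {F : Type*} [Field F] [CharZero F] {G : Type*} [Group G] [Finite G]
    (hF : ∃ ζ : F, IsPrimitiveRoot ζ (Nat.card G))
    (N H : Subgroup G) (hNnormal : N.Normal) (hNH : N.IsComplement' H)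
    (hN : ∀ a ∈ N, ∀ b ∈ N, a * b = b * a) (hH : ∀ a ∈ H, ∀ b ∈ H, a * b = b * a) :
    (MulAction.toPermHom G (G ⧸ H)).ker = H ⊓ Subgroup.center G ∧
    StablyIsomorphic F
      (flowField F G H)
      (flowField F (G ⧸ (H ⊓ Subgroup.center G))
        (H.map (QuotientGroup.mk' (H ⊓ Subgroup.center G)))) :=
  ⟨toPermHom_ker_eq_inf_center hNnormal hNH hH,
    stablyIsomorphic_flowField H _ inf_le_left fun _ hh h1 =>
      exists_character_apply_ne_one hF hNnormal hNH hH hh.1 h1⟩
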